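/- Let $k\ge 2$ be an integer. A $k$-graph is a finite vertex set together with a set of $k$-element subsets of it (edges); for a family $\mathcal F$ of $k$-graphs, a $k$-graph is $\mathcal F$-free if it contains no member of $\mathcal F$ as a (not necessarily induced) sub-hypergraph. Let $\mathrm{ex}(n,\mathcal F)$ be the maximum number of edges of an $n$-vertex $\mathcal F$-free $k$-graph ($0$ if there is none), and let $\pi(\mathcal F)=\lim_{n\to\infty}\mathrm{ex}(n,\mathcal F)/\binom nk$. For $\alpha>1$ and a $k$-graph $G$ with vertex set $\{1,\dots,n\}$ and edge set $E(G)$, its $\alpha$-spectral radius is $$\lambda_\alpha(G)=\max_{|x_1|^\alpha+\cdots+|x_n|^\alpha=1}\; k!\sum_{\{i_1,\dots,i_k\}\in E(G)}x_{i_1}\cdots x_{i_k}.$$ Let $k\ge2$, $\alpha>1$, $0<\varepsilon<1$, and let $\mathcal F$ be a family of $k$-graphs with $\pi(\mathcal F)>0$. Let $\mathcal G_n$ be the collection of all $n$-vertex $\mathcal F$-free $k$-graphs with minimum degree at least $(1-\varepsilon)\pi(\mathcal F)\binom{n}{k-1}$, where the degree of a vertex is the number of edges containing it, and let $\lambda_\alpha(\mathcal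 G_n)=\max\{\lambda_\alpha(G):G\in\mathcal G_n\}$ (read as $0$ if $\mathcal G_n=\emptyset$). Put $\varepsilon'=\varepsilon\,\pi(\mathcal F)(\alpha-1)/(2k\alpha)$, and suppose that there is $N$ such that for all $n\ge N$ $$\lambda_\alpha(\mathcal G_n)\ \ge\ \lambda_\alpha(\mathcal G_{n-1})+(k-k/\alpha)(1-\varepsilon')\,\pi(\mathcal F)\,n^{k-k/\alpha-1}.$$ Then there exists $n_0$ such that every $\mathcal F$-free $k$-graph $H$ on $n\ge n_0$ vertices satisfies $\lambda_\alpha(H)\le\lambda_\alpha(\mathcal G_n)$; moreover, if equality holds, then $H\in\mathcal G_n$. -/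

import Mathlib

/-- A `k`-uniform hypergraph (`k`-graph) with vertex set `V`: a finite set of `k`-element
subsets of `V`. -/
@[ext]
structure KGraph (V : Type*) (k : ℕ) where
  edges : Finset (Finset V)
  uniform : ∀ e ∈ edges, e.card = k

/-- A family of finite `k`-graphs; every finite `k`-graph is taken, up to isomorphism, on a
vertex set `Fin m`. -/
abbrev KFamily (k : ℕ) := Set (Σ m : ℕ, KGraph (Fin m) k)

namespace KGraph

/-- `H` contains a copy of `F` as a (not necessarily induced) sub-hypergraph. -/
def Contains {V W : Type*} {k : ℕ} (H : KGraph V k) (F : KGraph W k) : Prop :=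
  ∃ φ : W ↪ V, ∀ e ∈ F.edges, e.map φ ∈ H.edges

/-- `H` contains no member of the family `𝓕` as a sub-hypergraph. -/
def IsFree {V : Type*} {k : ℕ} (𝓕 : KFamily k) (H : KGraph V k) : Prop :=
  ∀ F ∈ 𝓕, ¬ H.Contains F.2

/-- The number of edges containing the vertex `v`. -/
def degree {V : Type*} [DecidableEq V] {k : ℕ} (H : KGraph V k) (v : V) : ℕ :=
  (H.edges.filter (fun e => v ∈ e)).card

/-- The minimum degree (it is `0` if there are no vertices). -/
noncomputable def minDegree {V : Type*} [DecidableEq V] {k : ℕ} (H : KGraph V k) : ℕ :=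
  ⨅ v : V, H.degree v

/-- The Lagrangian polynomial `k! * ∑_{e ∈ E(H)} ∏_{v ∈ e} x_v`. -/
noncomputable def lagrangian {V : Type*} {k : ℕ} (H : KGraph V k) (x : V → ℝ) : ℝ :=
  (k.factorial : ℝ) * ∑ e ∈ H.edges, ∏ v ∈ e, x v

/-- The `α`-spectral radius: the maximum of the Lagrangian polynomial over the real vectors `x`
with `‖x‖_α = 1` (a compact nonempty set if there is at least one vertex; for no vertices the
value is `0`). -/
noncomputable def spectralRadius {V : Type*} [Fintype V] {k : ℕ} (α : ℝ) (H : KGraph V k) : ℝ :=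
  sSup {y : ℝ | ∃ x : V → ℝ, (∑ v, |x v| ^ α) ^ (1 / α) = 1 ∧ H.lagrangian x = y}

end KGraph

namespace KFamily

/-- The Turán number `ex(n, 𝓕)`: the maximum number of edges of an `𝓕`-free `k`-graph on `n`
vertices. -/
noncomputable def ex {k : ℕ} (𝓕 : KFamily k) (n : ℕ) : ℕ :=
  sSup {m : ℕ | ∃ G : KGraph (Fin n) k, G.IsFree 𝓕 ∧ G.edges.card = m}

/-- The Turán density `π(𝓕) = lim ex(n, 𝓕) / (n choose k)`. -/
noncomputable def density {k : ℕ} (𝓕 : KFamily k) : ℝ :=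
  Filter.limUnder Filter.atTop (fun n : ℕ => (𝓕.ex n : ℝ) / (n.choose k : ℝ))

/-- The `𝓕`-free `k`-graphs on `n` vertices with minimum degree at least
`(1 - ε) * π(𝓕) * (n choose (k - 1))`. -/
def largeMinDegree {k : ℕ} (𝓕 : KFamily k) (ε : ℝ) (n : ℕ) : Set (KGraph (Fin n) k) :=
  {G | G.IsFree 𝓕 ∧ (1 - ε) * 𝓕.density * (n.choose (k - 1) : ℝ) ≤ (G.minDegree : ℝ)}

end KFamily

/-- The maximum `α`-spectral radius over a set of `k`-graphs on `n` vertices. Such a set is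
finite, so this is a maximum if the set is nonempty; for the empty set the value is `0`. -/
noncomputable def maxSpectralRadius {k n : ℕ} (α : ℝ) (𝓖 : Set (KGraph (Fin n) k)) : ℝ :=
  sSup (KGraph.spectralRadius α '' 𝓖)

/-! Let `d n` be `maxFree`, the largest spectral radius of an `𝓕`-free `k`-graph on `n` vertices,
minus its analogue for `largeMinDegree`. If an extremal `k`-graph on `n + 1` vertices has a vertex
of small degree, deleting a suitable vertex costs less than the growth assumed in the hypothesis, so
`d (n + 1) + c / (n + 1) ≤ d n`. The harmonic series diverges, so `d` cannot stay positive; once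
nonpositive it remains so.

The cost of deletion rests on two facts. By `eventually_maxFree_le`, the radius is at most `(π +
o(1)) n ^ (k - k / α)`: fix `m` with `ex m / m.choose k` near the density `π` and average over
`m`-sets of vertices, weighted by the products of the coordinates of a maximal vector. By
`eventually_exists_rpow_lt`, a vertex of small degree forces some coordinate with `x u ^ α < b / n`,
where `b < 1`. Otherwise the vector is nearly constant, and the eigenvalue equation
(`factorial_mul_sum_edges_eq`) at the low-degree vertex contradicts the lower bound on the radius
given by constant vectors.

Deleting the vertex of the small coordinate loses about `(k - k / α) * (x u ^ α)` times the radius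
(`spectralRadius_le_add_comap`), and `eventually_maxFree_succ_le` combines these estimates. -/

open Finset Filter Topology

/-! ### Elementary symmetric sums -/

section ElementarySymmetric

variable {V : Type*} [DecidableEq V]

lemma sum_powersetCard_superset (s e : Finset V) (h : e ⊆ s) (m : ℕ) (hm : e.card ≤ m)
    (x : V → ℝ) :
    ∑ t ∈ s.powersetCard m with e ⊆ t, ∏ i ∈ t, x i =
      (∏ i ∈ e, x i) * ∑ t ∈ (s \ e).powersetCard (m - e.card), ∏ i ∈ t, x i := by
  rw [Finset.mul_sum]
  refine Finset.sum_bij' (fun t _ => t \ e) (fun t _ => t ∪ e) ?_ ?_ ?_ ?_ ?_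
  · intro t ht
    simp only [mem_filter, mem_powersetCard] at ht ⊢
    exact ⟨sdiff_subset_sdiff ht.1.1 le_rfl, by rw [card_sdiff_of_subset ht.2, ht.1.2]⟩
  · intro t ht
    simp only [mem_filter, mem_powersetCard] at ht ⊢
    refine ⟨⟨union_subset (ht.1.trans sdiff_subset) h, ?_⟩, subset_union_right⟩
    rw [card_union_of_disjoint (disjoint_of_subset_left ht.1 sdiff_disjoint), ht.2]
    omega
  · intro t ht
    simp only [mem_filter, mem_powersetCard] at ht
    exact sdiff_union_of_subset ht.2
  · intro t ht
    simp only [mem_powersetCard] at ht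
    exact union_sdiff_cancel_right (disjoint_of_subset_left ht.1 sdiff_disjoint)
  · intro t ht
    simp only [mem_filter, mem_powersetCard] at ht
    rw [mul_comm, prod_sdiff ht.2]

lemma succ_mul_sum_powersetCard (s : Finset V) (j : ℕ) (x : V → ℝ) :
    ((j : ℝ) + 1) * ∑ t ∈ s.powersetCard (j + 1), ∏ i ∈ t, x i =
      ∑ i ∈ s, x i * ∑ t ∈ (s.erase i).powersetCard j, ∏ l ∈ t, x l := by
  have h1 : ∀ i ∈ s, x i * ∑ t ∈ (s.erase i).powersetCard j, ∏ l ∈ t, x l =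
      ∑ t ∈ s.powersetCard (j + 1), if i ∈ t then ∏ l ∈ t, x l else 0 := by
    intro i hi
    have := sum_powersetCard_superset s {i} (by simpa using hi) (j + 1) (by simp) x
    simp only [singleton_subset_iff, prod_singleton, card_singleton, Nat.add_sub_cancel,
      sdiff_singleton_eq_erase] at this
    rw [← this, sum_filter]
  rw [sum_congr rfl h1, sum_comm, mul_sum]
  refine sum_congr rfl fun t ht => ?_
  rw [mem_powersetCard] at ht
  rw [← sum_filter, filter_mem_eq_inter, inter_eq_right.2 ht.1, sum_const, ht.2]
  simp

lemma factorial_mul_sum_powersetCard_le (j : ℕ) (s : Finset V) (x : V → ℝ)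
    (hx : ∀ i ∈ s, 0 ≤ x i) :
    (j.factorial : ℝ) * ∑ t ∈ s.powersetCard j, ∏ i ∈ t, x i ≤ (∑ i ∈ s, x i) ^ j := by
  induction j generalizing s with
  | zero => simp
  | succ j ih =>
    have h := succ_mul_sum_powersetCard s j x
    calc ((j + 1).factorial : ℝ) * ∑ t ∈ s.powersetCard (j + 1), ∏ i ∈ t, x i
        = ∑ i ∈ s, x i * (j.factorial *
            ∑ t ∈ (s.erase i).powersetCard j, ∏ l ∈ t, x l) := by
          rw [Nat.factorial_succ]
          push_cast
          rw [mul_comm ((j : ℝ) + 1), mul_assoc, h, mul_sum]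
          exact sum_congr rfl fun i _ => by ring
      _ ≤ ∑ i ∈ s, x i * (∑ i ∈ s, x i) ^ j := by
          refine sum_le_sum fun i hi => mul_le_mul_of_nonneg_left ?_ (hx i hi)
          have hx' : ∀ l ∈ s.erase i, 0 ≤ x l := fun l hl => hx l (mem_of_mem_erase hl)
          refine (ih _ hx').trans (pow_le_pow_left₀ (sum_nonneg hx') ?_ j)
          exact sum_le_sum_of_subset_of_nonneg (erase_subset _ _) fun l hl _ => hx l hl
      _ = _ := by rw [← sum_mul, pow_succ']

/-- Removing one coordinate lowers the sum by at most `1`, which is exactly what the induction on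
`j` can afford. With the previous bound, the elementary symmetric sum is close to a power once the
sum is large compared with `j`. -/
lemma le_factorial_mul_sum_powersetCard (j : ℕ) (s : Finset V) (x : V → ℝ)
    (hx : ∀ i ∈ s, 0 ≤ x i) (hx1 : ∀ i ∈ s, x i ≤ 1) (hs : (j : ℝ) ≤ ∑ i ∈ s, x i) :
    (∑ i ∈ s, x i - j) ^ j ≤
      (j.factorial : ℝ) * ∑ t ∈ s.powersetCard j, ∏ i ∈ t, x i := by
  induction j generalizing s with
  | zero => simp
  | succ j ih =>
    have h := succ_mul_sum_powersetCard s j x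
    push_cast at hs ⊢
    set S := ∑ i ∈ s, x i with hS
    calc (S - (j + 1)) ^ (j + 1)
        ≤ ∑ i ∈ s, x i * (S - (j + 1)) ^ j := by
          rw [← sum_mul, pow_succ']
          refine mul_le_mul_of_nonneg_right ?_ (pow_nonneg (by linarith) _)
          linarith [(Nat.cast_nonneg j : (0 : ℝ) ≤ j)]
      _ ≤ ∑ i ∈ s, x i * (j.factorial *
            ∑ t ∈ (s.erase i).powersetCard j, ∏ l ∈ t, x l) := by
          refine sum_le_sum fun i hi => mul_le_mul_of_nonneg_left ?_ (hx i hi)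
          have he : ∑ l ∈ s.erase i, x l = S - x i := by
            rw [hS, ← add_sum_erase s x hi]; ring
          have h1 := hx1 i hi
          have := ih (s.erase i) (fun l hl => hx l (mem_of_mem_erase hl))
            (fun l hl => hx1 l (mem_of_mem_erase hl)) (by rw [he]; linarith)
          refine le_trans (pow_le_pow_left₀ (by linarith) ?_ j) this
          rw [he]; linarith
      _ = ((j + 1).factorial : ℝ) * ∑ t ∈ s.powersetCard (j + 1), ∏ i ∈ t, x i := by
          rw [Nat.factorial_succ]
          push_cast
          rw [mul_comm ((j : ℝ) + 1), mul_assoc, h, mul_sum]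
          exact sum_congr rfl fun i _ => by ring

end ElementarySymmetric

/-! ### Induced sub-hypergraphs -/

namespace KGraph

variable {V W : Type*} {k : ℕ}

/-- The `k`-graph on `W` induced by `H` along an embedding of `W` into its vertex set. -/
noncomputable def comap (H : KGraph V k) (φ : W ↪ V) : KGraph W k where
  edges := H.edges.preimage (Finset.map φ) (Finset.map_injective φ).injOn
  uniform e he := by
    have := H.uniform _ (Finset.mem_preimage.1 he)
    rwa [Finset.card_map] at this

lemma mem_edges_comap {H : KGraph V k} {φ : W ↪ V} {e : Finset W} :
    e ∈ (H.comap φ).edges ↔ e.map φ ∈ H.edges := by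
  rw [comap, Finset.mem_preimage]

lemma IsFree.comap {𝓕 : KFamily k} {H : KGraph V k} (h : H.IsFree 𝓕) (φ : W ↪ V) :
    (H.comap φ).IsFree 𝓕 := by
  rintro F hF ⟨ψ, hψ⟩
  refine h F hF ⟨ψ.trans φ, fun e he => ?_⟩
  rw [← Finset.map_map]
  exact mem_edges_comap.1 (hψ e he)

lemma sum_edges_comap [DecidableEq V] [Fintype W] (H : KGraph V k) (φ : W ↪ V)
    (f : Finset V → ℝ) :
    ∑ e ∈ (H.comap φ).edges, f (e.map φ) =
      ∑ e ∈ H.edges with e ⊆ univ.map φ, f e := by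
  refine sum_bij (fun e _ => e.map φ) ?_ ?_ ?_ ?_
  · intro e he
    exact mem_filter.2 ⟨mem_edges_comap.1 he, map_subset_map.2 (subset_univ _)⟩
  · intro a _ b _ hab
    exact Finset.map_injective φ hab
  · intro e he
    rw [mem_filter] at he
    obtain ⟨t, -, rfl⟩ := subset_map_iff.1 he.2
    exact ⟨t, mem_edges_comap.2 he.1, rfl⟩
  · simp

instance finite [Finite V] : Finite (KGraph V k) :=
  Finite.of_injective (fun H : KGraph V k => H.edges) fun _ _ h => KGraph.ext h

end KGraph

/-! ### Double counting and the Turán density -/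

namespace KFamily

variable {k : ℕ} {V : Type*}

lemma bddAbove_card_edges (𝓕 : KFamily k) (n : ℕ) :
    BddAbove {m : ℕ | ∃ G : KGraph (Fin n) k, G.IsFree 𝓕 ∧ G.edges.card = m} := by
  refine ((Set.finite_range fun G : KGraph (Fin n) k => G.edges.card).subset ?_).bddAbove
  rintro m ⟨G, -, rfl⟩
  exact ⟨G, rfl⟩

lemma card_edges_filter_subset_le_ex [DecidableEq V] {𝓕 : KFamily k} {H : KGraph V k}
    (hH : H.IsFree 𝓕) {m : ℕ} {M : Finset V} (hM : M.card = m) :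
    ({e ∈ H.edges | e ⊆ M}).card ≤ 𝓕.ex m := by
  let φ : Fin m ↪ V := (M.equivFinOfCardEq hM).symm.toEmbedding.trans (.subtype _)
  have hφ : univ.map φ = M := by
    ext v
    simp only [φ, Finset.mem_map, mem_univ, true_and, Function.Embedding.trans_apply,
      Equiv.coe_toEmbedding, Function.Embedding.coe_subtype]
    constructor
    · rintro ⟨i, rfl⟩
      exact Subtype.prop _
    · intro hv
      exact ⟨M.equivFinOfCardEq hM ⟨v, hv⟩, by simp⟩
  have h := H.sum_edges_comap φ (fun _ => 1)
  rw [hφ] at h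
  simp only [sum_const, nsmul_eq_mul, mul_one, Nat.cast_inj] at h
  rw [← h]
  exact le_csSup (𝓕.bddAbove_card_edges m) ⟨_, hH.comap φ, rfl⟩

/-- Weighted double counting of the edges inside the `m`-element sets of vertices. -/
lemma sum_edges_mul_sum_powersetCard_le [Fintype V] [DecidableEq V] {𝓕 : KFamily k}
    {H : KGraph V k} (hH : H.IsFree 𝓕) {m : ℕ} (hm : k ≤ m) (x : V → ℝ) (hx : ∀ v, 0 ≤ x v) :
    ∑ e ∈ H.edges, (∏ v ∈ e, x v) * ∑ t ∈ (univ \ e).powersetCard (m - k), ∏ v ∈ t, x v ≤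
      𝓕.ex m * ∑ M ∈ univ.powersetCard m, ∏ v ∈ M, x v := by
  calc _ = ∑ e ∈ H.edges, ∑ M ∈ univ.powersetCard m, if e ⊆ M then ∏ v ∈ M, x v else 0 := by
        refine sum_congr rfl fun e he => ?_
        have hc := H.uniform e he
        have := sum_powersetCard_superset univ e (subset_univ _) m (by omega) x
        rw [hc] at this
        rw [← this, sum_filter]
    _ = ∑ M ∈ univ.powersetCard m, (({e ∈ H.edges | e ⊆ M}).card : ℝ) * ∏ v ∈ M, x v := by
        rw [sum_comm]
        refine sum_congr rfl fun M _ => ?_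
        rw [← sum_filter, sum_const, nsmul_eq_mul]
    _ ≤ _ := by
        rw [mul_sum]
        refine sum_le_sum fun M hM => mul_le_mul_of_nonneg_right ?_ (prod_nonneg fun v _ => hx v)
        exact_mod_cast card_edges_filter_subset_le_ex hH (mem_powersetCard.1 hM).2

/-- The weighted double count with all weights `1`: every edge of an extremal `k`-graph lies in `n +
1 - k` of the `n`-sets. -/
lemma ex_succ_mul_le (𝓕 : KFamily k) {n : ℕ} (hn : k ≤ n) :
    (𝓕.ex (n + 1) : ℝ) * (n + 1 - k) ≤ 𝓕.ex n * (n + 1) := by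
  rcases Set.eq_empty_or_nonempty
    {m : ℕ | ∃ G : KGraph (Fin (n + 1)) k, G.IsFree 𝓕 ∧ G.edges.card = m} with h | h
  · have : 𝓕.ex (n + 1) = 0 := by rw [ex, h, csSup_empty]; rfl
    rw [this]
    simp only [Nat.cast_zero, zero_mul]
    positivity
  · obtain ⟨G, hG, hGe⟩ := Nat.sSup_mem h (𝓕.bddAbove_card_edges _)
    have := sum_edges_mul_sum_powersetCard_le hG hn (fun _ => 1) (fun _ => zero_le_one)
    simp only [prod_const_one, sum_const, card_powersetCard, nsmul_eq_mul, mul_one, one_mul] at this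
    have h2 : ∀ e ∈ G.edges, (((univ \ e).card.choose (n - k) : ℕ) : ℝ) = n + 1 - k := by
      intro e he
      have hc : (univ \ e).card = (n - k) + 1 := by
        rw [card_sdiff_of_subset (subset_univ _), G.uniform e he, card_univ, Fintype.card_fin]
        omega
      rw [hc, Nat.choose_succ_self_right]
      push_cast [hn]
      ring
    rw [sum_congr rfl h2, sum_const, nsmul_eq_mul, card_univ, Fintype.card_fin,
      Nat.choose_succ_self_right] at this
    rw [ex, ← hGe]
    exact_mod_cast this

/-- The ratios decrease from `n = k` on and are bounded below, so the limit exists and `limUnder` is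
not a junk value. -/
lemma tendsto_density (𝓕 : KFamily k) :
    Tendsto (fun n : ℕ => (𝓕.ex n : ℝ) / (n.choose k : ℝ)) atTop (𝓝 𝓕.density) := by
  refine tendsto_nhds_limUnder ?_
  set f : ℕ → ℝ := fun n => (𝓕.ex n : ℝ) / (n.choose k : ℝ) with hf
  have hanti : Antitone fun n => f (n + k) := by
    refine antitone_nat_of_succ_le fun n => ?_
    have h1 : (0 : ℝ) < ((n + k).choose k : ℝ) := by
      exact_mod_cast Nat.choose_pos (by omega)
    have h2 : (0 : ℝ) < ((n + k + 1).choose k : ℝ) := by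
      exact_mod_cast Nat.choose_pos (by omega)
    have h3 := 𝓕.ex_succ_mul_le (n := n + k) (by omega)
    have h4 : ((n + k).choose k : ℝ) * ((n + k : ℕ) + 1) =
        ((n + k + 1).choose k : ℝ) * (n + 1) := by
      have := Nat.choose_mul_succ_eq (n + k) k
      rw [show n + k + 1 - k = n + 1 by omega] at this
      exact_mod_cast this
    simp only [hf]
    rw [show n + 1 + k = n + k + 1 by omega, div_le_div_iff₀ h2 h1]
    push_cast at h3 h4
    have hn : (0 : ℝ) < (n : ℝ) + 1 := by positivity
    refine le_of_mul_le_mul_right ?_ hn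
    calc (𝓕.ex (n + k + 1) : ℝ) * ((n + k).choose k : ℝ) * ((n : ℝ) + 1)
        = (𝓕.ex (n + k + 1) * ((n : ℝ) + k + 1 - k)) * ((n + k).choose k : ℝ) := by ring
      _ ≤ (𝓕.ex (n + k) * ((n : ℝ) + k + 1)) * ((n + k).choose k : ℝ) :=
          mul_le_mul_of_nonneg_right h3 h1.le
      _ = 𝓕.ex (n + k) * (((n + k).choose k : ℝ) * ((n : ℝ) + k + 1)) := by ring
      _ = _ := by rw [h4]; ring
  have hb : BddBelow (Set.range fun n => f (n + k)) := by
    refine ⟨0, ?_⟩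
    rintro _ ⟨n, rfl⟩
    exact div_nonneg (Nat.cast_nonneg _) (Nat.cast_nonneg _)
  exact ⟨_, (tendsto_add_atTop_iff_nat k).1 (tendsto_atTop_ciInf hanti hb)⟩

/-- `ex` defaults to `0` when there is no free `k`-graph, so positive density yields free ones on
arbitrarily many vertices, and these restrict to `n` vertices. -/
lemma exists_isFree {𝓕 : KFamily k} (hπ : 0 < 𝓕.density) (n : ℕ) :
    ∃ G : KGraph (Fin n) k, G.IsFree 𝓕 := by
  obtain ⟨m, hm, hnm⟩ :=
    (((tendsto_density 𝓕).eventually (lt_mem_nhds hπ)).and (eventually_ge_atTop n)).exists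
  have hne : {j : ℕ | ∃ G : KGraph (Fin m) k, G.IsFree 𝓕 ∧ G.edges.card = j}.Nonempty := by
    by_contra h
    rw [Set.not_nonempty_iff_eq_empty] at h
    rw [ex, h, csSup_empty] at hm
    simp at hm
  obtain ⟨_, G, hG, -⟩ := hne
  exact ⟨_, hG.comap (Fin.castLEEmb hnm)⟩

lemma exists_card_edges_eq_ex {𝓕 : KFamily k} (hπ : 0 < 𝓕.density) (n : ℕ) :
    ∃ G : KGraph (Fin n) k, G.IsFree 𝓕 ∧ G.edges.card = 𝓕.ex n := by
  obtain ⟨G, hG⟩ := exists_isFree hπ n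
  exact Nat.sSup_mem (s := {m : ℕ | ∃ G : KGraph (Fin n) k, G.IsFree 𝓕 ∧ G.edges.card = m})
    ⟨_, G, hG, rfl⟩ (𝓕.bddAbove_card_edges n)

end KFamily

/-! ### Spectral radius, maximal vectors and the eigenvalue equation -/

namespace KGraph

variable {V : Type*} {k : ℕ}

lemma lagrangian_nonneg (H : KGraph V k) {x : V → ℝ} (hx : ∀ v, 0 ≤ x v) :
    0 ≤ H.lagrangian x :=
  mul_nonneg (Nat.cast_nonneg _) (sum_nonneg fun _ _ => prod_nonneg fun v _ => hx v)

lemma lagrangian_le_abs (H : KGraph V k) (x : V → ℝ) :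
    H.lagrangian x ≤ H.lagrangian fun v => |x v| := by
  refine mul_le_mul_of_nonneg_left (sum_le_sum fun e _ => ?_) (Nat.cast_nonneg _)
  rw [← abs_prod]
  exact le_abs_self _

lemma lagrangian_const_mul (H : KGraph V k) (c : ℝ) (x : V → ℝ) :
    H.lagrangian (fun v => c * x v) = c ^ k * H.lagrangian x := by
  unfold lagrangian
  rw [mul_left_comm, mul_sum (a := c ^ k)]
  congr 1
  refine sum_congr rfl fun e he => ?_
  rw [prod_mul_distrib, prod_const, H.uniform e he]

lemma lagrangian_zero (H : KGraph V k) (hk : k ≠ 0) : H.lagrangian (fun _ => 0) = 0 := by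
  have := H.lagrangian_const_mul 0 (fun _ => 0)
  simpa [hk] using this

lemma continuous_lagrangian (H : KGraph V k) : Continuous H.lagrangian := by
  unfold lagrangian
  fun_prop

variable [Fintype V] {α : ℝ}

lemma rpow_one_div_sum_eq_one_iff (hα : 0 < α) (x : V → ℝ) :
    (∑ v, |x v| ^ α) ^ (1 / α) = 1 ↔ ∑ v, |x v| ^ α = 1 := by
  have h0 : 0 ≤ ∑ v, |x v| ^ α := sum_nonneg fun v _ => Real.rpow_nonneg (abs_nonneg _) _
  rw [one_div, Real.rpow_inv_eq h0 zero_le_one hα.ne', Real.one_rpow]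

lemma exists_isGreatest_lagrangian [Nonempty V] (hα : 0 < α) (H : KGraph V k) :
    ∃ x : V → ℝ, (∀ v, 0 ≤ x v) ∧ ∑ v, x v ^ α = 1 ∧
      IsGreatest {y : ℝ | ∃ x : V → ℝ, (∑ v, |x v| ^ α) ^ (1 / α) = 1 ∧ H.lagrangian x = y}
        (H.lagrangian x) := by
  classical
  set K : Set (V → ℝ) := {x | ∑ v, |x v| ^ α = 1}
  have hcont : Continuous fun x : V → ℝ => ∑ v, |x v| ^ α :=
    continuous_finsetSum _ fun v _ =>
      (continuous_apply v).abs.rpow_const fun _ => Or.inr hα.le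
  have hcl : IsClosed K := isClosed_eq hcont continuous_const
  have hcp : IsCompact K := by
    refine IsCompact.of_isClosed_subset
      (isCompact_univ_pi fun _ : V => isCompact_Icc (a := (-1 : ℝ)) (b := 1)) hcl ?_
    intro x hx v _
    refine abs_le.1 ?_
    by_contra! h
    have h1 : |x v| ^ α ≤ ∑ v, |x v| ^ α :=
      single_le_sum (f := fun v => |x v| ^ α)
        (fun v _ => Real.rpow_nonneg (abs_nonneg _) _) (mem_univ v)
    have h2 := Real.one_lt_rpow h hα
    have h3 : ∑ v, |x v| ^ α = 1 := hx
    linarith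
  have hne : K.Nonempty := by
    obtain ⟨v⟩ := ‹Nonempty V›
    refine ⟨Pi.single v 1, ?_⟩
    change ∑ w, |(Pi.single v 1 : V → ℝ) w| ^ α = 1
    rw [sum_eq_single v]
    · simp
    · intro w _ hw
      simp [hw, hα.ne']
    · simp
  obtain ⟨x, hx, hmax⟩ := hcp.exists_isMaxOn hne H.continuous_lagrangian.continuousOn
  refine ⟨fun v => |x v|, fun v => abs_nonneg _, hx, ⟨fun v => |x v|, ?_, rfl⟩, ?_⟩
  · rw [rpow_one_div_sum_eq_one_iff hα]
    simp only [abs_abs]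
    exact hx
  · rintro _ ⟨y, hy, rfl⟩
    rw [rpow_one_div_sum_eq_one_iff hα] at hy
    exact (hmax hy).trans (H.lagrangian_le_abs x)

/-- The spectral radius is attained at a nonnegative vector. -/
lemma exists_lagrangian_eq_spectralRadius [Nonempty V] (hα : 0 < α) (H : KGraph V k) :
    ∃ x : V → ℝ, (∀ v, 0 ≤ x v) ∧ ∑ v, x v ^ α = 1 ∧ H.lagrangian x = H.spectralRadius α := by
  obtain ⟨x, h0, h1, h⟩ := H.exists_isGreatest_lagrangian hα
  exact ⟨x, h0, h1, h.csSup_eq.symm⟩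

lemma spectralRadius_nonneg [Nonempty V] (hα : 0 < α) (H : KGraph V k) :
    0 ≤ H.spectralRadius α := by
  obtain ⟨x, h0, -, h⟩ := H.exists_lagrangian_eq_spectralRadius hα
  rw [← h]
  exact H.lagrangian_nonneg h0

lemma lagrangian_le_of_sum_eq_one [Nonempty V] (hα : 0 < α) (H : KGraph V k) {x : V → ℝ}
    (hx : ∀ v, 0 ≤ x v) (h1 : ∑ v, x v ^ α = 1) : H.lagrangian x ≤ H.spectralRadius α := by
  obtain ⟨y, -, -, h⟩ := H.exists_isGreatest_lagrangian hα
  refine le_csSup ⟨_, h.2⟩ ⟨x, ?_, rfl⟩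
  rw [rpow_one_div_sum_eq_one_iff hα]
  simpa only [abs_of_nonneg (hx _)] using h1

lemma lagrangian_le_spectralRadius_mul [Nonempty V] (hk : k ≠ 0) (hα : 0 < α) (H : KGraph V k)
    {x : V → ℝ} (hx : ∀ v, 0 ≤ x v) :
    H.lagrangian x ≤ H.spectralRadius α * (∑ v, x v ^ α) ^ ((k : ℝ) / α) := by
  set T := ∑ v, x v ^ α with hT
  have hT0 : 0 ≤ T := sum_nonneg fun v _ => Real.rpow_nonneg (hx v) _
  rcases hT0.eq_or_lt with h | h
  · have hz : x = fun _ => 0 := by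
      funext v
      have := (sum_eq_zero_iff_of_nonneg fun v _ => Real.rpow_nonneg (hx v) α).1
        (hT.symm.trans h.symm) v (mem_univ v)
      exact ((Real.rpow_eq_zero (hx v) hα.ne').1 this)
    rw [hz, H.lagrangian_zero hk]
    exact mul_nonneg (H.spectralRadius_nonneg hα) (Real.rpow_nonneg hT0 _)
  · have hc : 0 < T ^ (-(1 / α)) := Real.rpow_pos_of_pos h _
    have h1 := H.lagrangian_le_of_sum_eq_one hα (x := fun v => T ^ (-(1 / α)) * x v)
      (fun v => mul_nonneg hc.le (hx v)) (by
        have : ∀ v, (T ^ (-(1 / α)) * x v) ^ α = T⁻¹ * x v ^ α := by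
          intro v
          rw [Real.mul_rpow hc.le (hx v), ← Real.rpow_mul hT0]
          congr 1
          rw [show -(1 / α) * α = -1 by field_simp, Real.rpow_neg_one]
        simp only [this, ← mul_sum, ← hT]
        exact inv_mul_cancel₀ h.ne')
    rw [lagrangian_const_mul, ← Real.rpow_natCast, ← Real.rpow_mul hT0,
      show -(1 / α) * (k : ℝ) = -((k : ℝ) / α) by ring, Real.rpow_neg hT0,
      inv_mul_le_iff₀ (Real.rpow_pos_of_pos h _)] at h1
    linarith

lemma factorial_mul_card_edges_le [Nonempty V] (hk : k ≠ 0) (hα : 0 < α) (H : KGraph V k) :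
    (k.factorial : ℝ) * H.edges.card ≤
      H.spectralRadius α * (Fintype.card V : ℝ) ^ ((k : ℝ) / α) := by
  have := H.lagrangian_le_spectralRadius_mul hk hα (x := fun _ => 1) (fun _ => zero_le_one)
  simpa [lagrangian] using this

lemma sum_le_card_rpow (hα : 1 < α) {x : V → ℝ} (hx : ∀ v, 0 ≤ x v)
    (h1 : ∑ v, x v ^ α = 1) : ∑ v, x v ≤ (Fintype.card V : ℝ) ^ (1 - 1 / α) := by
  have hα0 : 0 < α := by linarith
  have h := Real.rpow_sum_le_const_mul_sum_rpow_of_nonneg (univ : Finset V) hα.le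
    (f := x) (fun v _ => hx v)
  rw [h1, mul_one, card_univ] at h
  have h2 := Real.rpow_le_rpow (Real.rpow_nonneg (sum_nonneg fun v _ => hx v) _) h
    (show (0 : ℝ) ≤ 1 / α by positivity)
  rw [← Real.rpow_mul (sum_nonneg fun v _ => hx v), ← Real.rpow_mul (Nat.cast_nonneg _)] at h2
  rw [show α * (1 / α) = 1 by field_simp, Real.rpow_one] at h2
  rwa [show 1 - 1 / α = (α - 1) * (1 / α) by field_simp]

lemma le_one_of_sum_rpow_eq_one (hα : 0 < α) {x : V → ℝ} (hx : ∀ v, 0 ≤ x v)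
    (h1 : ∑ v, x v ^ α = 1) (v : V) : x v ≤ 1 := by
  by_contra! h
  have h2 : x v ^ α ≤ ∑ v, x v ^ α :=
    single_le_sum (f := fun v => x v ^ α) (fun v _ => Real.rpow_nonneg (hx v) _) (mem_univ v)
  have := Real.one_lt_rpow h hα
  linarith

lemma lagrangian_le_sum_pow [DecidableEq V] (H : KGraph V k) {x : V → ℝ} (hx : ∀ v, 0 ≤ x v) :
    H.lagrangian x ≤ (∑ v, x v) ^ k := by
  refine le_trans ?_ (factorial_mul_sum_powersetCard_le k univ x fun v _ => hx v)
  refine mul_le_mul_of_nonneg_left ?_ (Nat.cast_nonneg _)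
  refine sum_le_sum_of_subset_of_nonneg (fun e he => ?_) fun e _ _ => prod_nonneg fun v _ => hx v
  exact mem_powersetCard.2 ⟨subset_univ _, H.uniform e he⟩

/-- The eigenvalue equation of a maximal vector, in the coordinate `u`. -/
lemma factorial_mul_sum_edges_eq [Nonempty V] [DecidableEq V] (hk : k ≠ 0) (hα : 0 < α)
    (H : KGraph V k) {x : V → ℝ} (hx : ∀ v, 0 ≤ x v) (h1 : ∑ v, x v ^ α = 1)
    (hmax : H.lagrangian x = H.spectralRadius α) (u : V) :
    (k.factorial : ℝ) * ∑ e ∈ H.edges with u ∈ e, ∏ v ∈ e, x v =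
      k * H.spectralRadius α * x u ^ α := by
  set l := H.spectralRadius α with hl
  set B := ∑ e ∈ H.edges with u ∈ e, ∏ v ∈ e, x v with hB
  set A := ∑ e ∈ H.edges with u ∉ e, ∏ v ∈ e, x v with hA
  set z := x u ^ α with hz
  have hAB : k.factorial * (A + B) = l := by
    rw [← hmax, lagrangian, add_comm, hA, hB, sum_filter_add_sum_filter_not]
  -- Rescaling one coordinate by `t` makes everything a function of one real variable with a maximum
  -- at `t = 1`; no separate case `x u = 0` is needed.
  have hL : ∀ t : ℝ, H.lagrangian (Function.update x u (t * x u)) = k.factorial * (A + t * B) := by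
    intro t
    rw [lagrangian, ← sum_filter_add_sum_filter_not H.edges (fun e => u ∈ e), add_comm]
    congr 2
    · refine sum_congr rfl fun e he => ?_
      exact prod_update_of_notMem (mem_filter.1 he).2 _ _
    · rw [hB, mul_sum]
      refine sum_congr rfl fun e he => ?_
      have hu := (mem_filter.1 he).2
      rw [prod_update_of_mem hu, mul_assoc, sdiff_singleton_eq_erase, mul_prod_erase e x hu]
  have hS : ∀ t : ℝ, 0 ≤ t →
      ∑ v, (Function.update x u (t * x u)) v ^ α = 1 + (t ^ α - 1) * z := by
    intro t ht
    rw [← add_sum_erase _ _ (mem_univ u), Function.update_self, Real.mul_rpow ht (hx u)]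
    have h2 : ∑ v ∈ univ.erase u, (Function.update x u (t * x u)) v ^ α =
        ∑ v ∈ univ.erase u, x v ^ α :=
      sum_congr rfl fun v hv => by rw [Function.update_of_ne (ne_of_mem_erase hv)]
    rw [h2]
    rw [← add_sum_erase _ _ (mem_univ u)] at h1
    linarith
  have hd : HasDerivAt (fun t : ℝ => k.factorial * (A + t * B) -
      l * (1 + (t ^ α - 1) * z) ^ ((k : ℝ) / α))
      (k.factorial * B - l * (k * z)) 1 := by
    have d1 : HasDerivAt (fun t : ℝ => k.factorial * (A + t * B)) (k.factorial * B) 1 := by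
      simpa using (((hasDerivAt_id (1 : ℝ)).mul_const B).const_add A).const_mul (k.factorial : ℝ)
    have d2 : HasDerivAt (fun t : ℝ => 1 + (t ^ α - 1) * z) (α * z) 1 := by
      have := ((((hasDerivAt_id (1 : ℝ)).rpow_const (p := α)
        (Or.inl one_ne_zero)).sub_const 1).mul_const z).const_add 1
      simpa using this
    have d3 := d2.rpow_const (p := (k : ℝ) / α) (Or.inl (by simp))
    have d4 := d1.sub (d3.const_mul l)
    refine d4.congr_deriv ?_
    simp only [Real.one_rpow, sub_self, zero_mul, add_zero, mul_one]
    field_simp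
  have hloc : IsLocalMax (fun t : ℝ => k.factorial * (A + t * B) -
      l * (1 + (t ^ α - 1) * z) ^ ((k : ℝ) / α)) 1 := by
    filter_upwards [lt_mem_nhds (zero_lt_one : (0 : ℝ) < 1)] with t ht
    have h3 := H.lagrangian_le_spectralRadius_mul hk hα
      (x := Function.update x u (t * x u)) (fun v => by
        rcases eq_or_ne v u with rfl | h
        · rw [Function.update_self]; exact mul_nonneg ht.le (hx _)
        · rw [Function.update_of_ne h]; exact hx v)
    rw [hL, hS t ht.le] at h3
    simp only [Real.one_rpow, sub_self, zero_mul, add_zero, mul_one, one_mul, hAB]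
    linarith
  linarith [hloc.hasDerivAt_eq_zero hd]

/-- Test the `k`-graph without `u` on the restriction of `x`: by the eigenvalue equation the edges
through `u` contribute `k * x u ^ α` times the radius. -/
lemma spectralRadius_sub_le {n : ℕ} (hn : n ≠ 0) (hk : k ≠ 0) (hα : 0 < α)
    (H : KGraph (Fin (n + 1)) k)
    {x : Fin (n + 1) → ℝ} (hx : ∀ v, 0 ≤ x v) (h1 : ∑ v, x v ^ α = 1)
    (hmax : H.lagrangian x = H.spectralRadius α) (u : Fin (n + 1)) :
    H.spectralRadius α * (1 - k * x u ^ α) ≤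
      (H.comap u.succAboveEmb).spectralRadius α * (1 - x u ^ α) ^ ((k : ℝ) / α) := by
  have : Nonempty (Fin n) := ⟨⟨0, Nat.pos_of_ne_zero hn⟩⟩
  have h := (H.comap u.succAboveEmb).lagrangian_le_spectralRadius_mul hk hα
    (x := fun i => x (u.succAbove i)) (fun i => hx _)
  have hs : ∑ i, x (u.succAbove i) ^ α = 1 - x u ^ α := by
    rw [Fin.sum_univ_succAbove _ u] at h1
    linarith
  have hE := H.factorial_mul_sum_edges_eq hk hα hx h1 hmax u
  have hc : (H.comap u.succAboveEmb).lagrangian (fun i => x (u.succAbove i)) =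
      H.lagrangian x - k.factorial * ∑ e ∈ H.edges with u ∈ e, ∏ v ∈ e, x v := by
    have h3 := H.sum_edges_comap u.succAboveEmb (fun e => ∏ v ∈ e, x v)
    have h4 : ∀ e : Finset (Fin (n + 1)), e ⊆ univ.map u.succAboveEmb ↔ u ∉ e := by
      intro e
      constructor
      · intro he hu
        obtain ⟨i, -, hi⟩ := Finset.mem_map.1 (he hu)
        exact Fin.succAbove_ne u i hi
      · intro hu w hw
        have hwu : w ≠ u := fun h => hu (h ▸ hw)
        obtain ⟨i, rfl⟩ := Fin.exists_succAbove_eq hwu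
        exact Finset.mem_map.2 ⟨i, mem_univ _, rfl⟩
    simp only [prod_map, h4] at h3
    rw [lagrangian, lagrangian, ← sum_filter_add_sum_filter_not H.edges (fun e => u ∈ e), ← h3]
    simp only [Fin.coe_succAboveEmb]
    ring
  rw [hs, hc, hE, hmax] at h
  linarith

/-- Weighted averaging over `m`-sets. The coordinates off an edge still sum to at least `S - k`,
where `S` is the full sum, so their symmetric sum of order `m - k` is bounded below, while the one
of order `m` over all vertices is bounded above. -/
lemma lagrangian_mul_pow_le [DecidableEq V] {𝓕 : KFamily k} {H : KGraph V k} (hH : H.IsFree 𝓕)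
    {m : ℕ} (hm : k ≤ m) {x : V → ℝ} (hx : ∀ v, 0 ≤ x v) (hx1 : ∀ v, x v ≤ 1)
    (hS : (m : ℝ) ≤ ∑ v, x v) :
    H.lagrangian x * (∑ v, x v - m) ^ (m - k) ≤
      (𝓕.ex m / m.choose k) * (∑ v, x v) ^ m := by
  set S := ∑ v, x v with hSdef
  have h1 : ∀ e ∈ H.edges, (∏ v ∈ e, x v) * (S - m) ^ (m - k) ≤
      ((m - k).factorial : ℝ) *
        ((∏ v ∈ e, x v) * ∑ t ∈ (univ \ e).powersetCard (m - k), ∏ v ∈ t, x v) := by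
    intro e he
    have hc := H.uniform e he
    have h2 : S - k ≤ ∑ v ∈ univ \ e, x v := by
      have h3 : ∑ v ∈ univ \ e, x v + ∑ v ∈ e, x v = S := sum_sdiff (subset_univ e)
      have h4 : ∑ v ∈ e, x v ≤ k := by
        rw [← hc]
        simpa using sum_le_card_nsmul e x 1 fun v _ => hx1 v
      linarith
    have hmk : ((m - k : ℕ) : ℝ) = m - k := by push_cast [hm]; ring
    have h5 := le_factorial_mul_sum_powersetCard (m - k) (univ \ e) x (fun v _ => hx v)
      (fun v _ => hx1 v) (by rw [hmk]; linarith)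
    rw [mul_left_comm]
    refine mul_le_mul_of_nonneg_left (le_trans ?_ h5) (prod_nonneg fun v _ => hx v)
    refine pow_le_pow_left₀ (by linarith) ?_ _
    rw [hmk]
    linarith
  have h2 := KFamily.sum_edges_mul_sum_powersetCard_le hH hm x hx
  have h3 := factorial_mul_sum_powersetCard_le m univ x fun v _ => hx v
  have hch : (m.choose k : ℝ) * k.factorial * (m - k).factorial = m.factorial := by
    exact_mod_cast Nat.choose_mul_factorial_mul_factorial hm
  have hpos : (0 : ℝ) < m.choose k := by exact_mod_cast Nat.choose_pos hm
  rw [div_mul_eq_mul_div, le_div_iff₀ hpos]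
  calc H.lagrangian x * (S - m) ^ (m - k) * m.choose k
      = m.choose k * k.factorial * ∑ e ∈ H.edges, (∏ v ∈ e, x v) * (S - m) ^ (m - k) := by
        rw [lagrangian, ← sum_mul]; ring
    _ ≤ m.choose k * k.factorial * ∑ e ∈ H.edges, ((m - k).factorial : ℝ) *
        ((∏ v ∈ e, x v) * ∑ t ∈ (univ \ e).powersetCard (m - k), ∏ v ∈ t, x v) :=
        mul_le_mul_of_nonneg_left (sum_le_sum h1) (by positivity)
    _ = m.factorial * ∑ e ∈ H.edges,
        ((∏ v ∈ e, x v) * ∑ t ∈ (univ \ e).powersetCard (m - k), ∏ v ∈ t, x v) := by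
        rw [← mul_sum, ← mul_assoc, hch]
    _ ≤ m.factorial * (𝓕.ex m * ∑ M ∈ univ.powersetCard m, ∏ v ∈ M, x v) :=
        mul_le_mul_of_nonneg_left h2 (Nat.cast_nonneg _)
    _ = 𝓕.ex m * (m.factorial * ∑ M ∈ univ.powersetCard m, ∏ v ∈ M, x v) := by ring
    _ ≤ 𝓕.ex m * S ^ m := mul_le_mul_of_nonneg_left h3 (Nat.cast_nonneg _)

end KGraph

/-! ### Extremal spectral radii and their order of growth -/

section MaxSpectralRadius

variable {k n : ℕ} {α : ℝ}

lemma spectralRadius_le_maxSpectralRadius {𝓖 : Set (KGraph (Fin n) k)} {H : KGraph (Fin n) k}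
    (hH : H ∈ 𝓖) : H.spectralRadius α ≤ maxSpectralRadius α 𝓖 :=
  le_csSup ((Set.toFinite 𝓖).image _).bddAbove ⟨H, hH, rfl⟩

lemma exists_spectralRadius_eq_max {𝓖 : Set (KGraph (Fin n) k)} (h : 𝓖.Nonempty) :
    ∃ H ∈ 𝓖, H.spectralRadius α = maxSpectralRadius α 𝓖 :=
  (h.image _).csSup_mem ((Set.toFinite 𝓖).image _)

end MaxSpectralRadius

lemma tendsto_factorial_mul_choose_div_pow (k : ℕ) :
    Tendsto (fun n : ℕ => (k.factorial : ℝ) * n.choose k / (n : ℝ) ^ k) atTop (𝓝 1) := by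
  have hz : ∀ᶠ n : ℕ in atTop, ((n : ℝ) ^ k / k.factorial : ℝ) ≠ 0 := by
    filter_upwards [eventually_gt_atTop 0] with n hn
    positivity
  have h := (Asymptotics.isEquivalent_iff_tendsto_one hz).1 (isEquivalent_choose k)
  refine h.congr fun n => ?_
  simp only [Pi.div_apply]
  rw [div_div_eq_mul_div, mul_comm]

namespace KFamily

variable {k : ℕ} {α : ℝ}

lemma tendsto_factorial_mul_ex_div_pow (𝓕 : KFamily k) :
    Tendsto (fun n : ℕ => (k.factorial : ℝ) * 𝓕.ex n / (n : ℝ) ^ k) atTop (𝓝 𝓕.density) := by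
  have h := (tendsto_density 𝓕).mul (tendsto_factorial_mul_choose_div_pow k)
  rw [mul_one] at h
  refine h.congr' ?_
  filter_upwards [eventually_ge_atTop k] with n hn
  have : (0 : ℝ) < n.choose k := by exact_mod_cast Nat.choose_pos hn
  field_simp

lemma density_le_one {𝓕 : KFamily k} (hπ : 0 < 𝓕.density) : 𝓕.density ≤ 1 := by
  refine le_of_tendsto (tendsto_density 𝓕) (Eventually.of_forall fun n => ?_)
  refine div_le_one_of_le₀ ?_ (Nat.cast_nonneg _)
  obtain ⟨G, -, hG⟩ := exists_card_edges_eq_ex hπ n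
  rw [← hG]
  have : G.edges ⊆ univ.powersetCard k :=
    fun e he => mem_powersetCard.2 ⟨subset_univ _, G.uniform e he⟩
  have := card_le_card this
  rw [card_powersetCard, card_univ, Fintype.card_fin] at this
  exact_mod_cast this

/-- The maximum `α`-spectral radius of an `𝓕`-free `k`-graph on `n` vertices. -/
noncomputable def maxFree (𝓕 : KFamily k) (α : ℝ) (n : ℕ) : ℝ :=
  maxSpectralRadius α {G : KGraph (Fin n) k | G.IsFree 𝓕}

lemma exists_spectralRadius_eq_maxFree {𝓕 : KFamily k} (hπ : 0 < 𝓕.density) (α : ℝ) (n : ℕ) :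
    ∃ H : KGraph (Fin n) k, H.IsFree 𝓕 ∧ H.spectralRadius α = 𝓕.maxFree α n :=
  exists_spectralRadius_eq_max (exists_isFree hπ n)

lemma spectralRadius_le_maxFree {𝓕 : KFamily k} {n : ℕ} {H : KGraph (Fin n) k}
    (hH : H.IsFree 𝓕) : H.spectralRadius α ≤ 𝓕.maxFree α n :=
  spectralRadius_le_maxSpectralRadius hH

/-- Evaluate a `k`-graph with `ex n` edges at a constant vector. -/
lemma ex_div_mul_pow_le_maxFree {𝓕 : KFamily k} (hk : k ≠ 0) (hα : 0 < α)
    (hπ : 0 < 𝓕.density) {n : ℕ} (hn : 0 < n) :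
    (k.factorial : ℝ) * 𝓕.ex n / (n : ℝ) ^ k * ((n : ℝ) ^ (1 - 1 / α)) ^ k ≤ 𝓕.maxFree α n := by
  obtain ⟨G, hG, hGe⟩ := exists_card_edges_eq_ex hπ n
  have : Nonempty (Fin n) := ⟨⟨0, hn⟩⟩
  have hn' : (0 : ℝ) < n := by exact_mod_cast hn
  have h := G.factorial_mul_card_edges_le hk hα
  rw [hGe, Fintype.card_fin, ← div_le_iff₀ (Real.rpow_pos_of_pos hn' _)] at h
  refine le_trans (le_of_eq ?_) (h.trans (spectralRadius_le_maxFree hG))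
  rw [Real.rpow_sub hn', Real.rpow_one, div_pow, ← Real.rpow_mul_natCast hn'.le,
    show 1 / α * (k : ℝ) = k / α by ring]
  have := Real.rpow_pos_of_pos hn' (k / α)
  field_simp

lemma tendsto_natCast_rpow_one_sub_inv (hα : 1 < α) :
    Tendsto (fun n : ℕ => (n : ℝ) ^ (1 - 1 / α)) atTop atTop := by
  refine (tendsto_rpow_atTop ?_).comp tendsto_natCast_atTop_atTop
  rw [sub_pos, div_lt_one (by linarith)]
  exact hα

lemma eventually_maxFree_le {𝓕 : KFamily k} (hk : k ≠ 0) (hα : 1 < α) (hπ : 0 < 𝓕.density)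
    {q : ℝ} (hq : 𝓕.density < q) :
    ∀ᶠ n : ℕ in atTop, 𝓕.maxFree α n ≤ q * ((n : ℝ) ^ (1 - 1 / α)) ^ k := by
  have hα0 : 0 < α := by linarith
  obtain ⟨m, hmq, hm⟩ :=
    (((tendsto_density 𝓕).eventually (gt_mem_nhds hq)).and (eventually_ge_atTop k)).exists
  set c : ℝ := (𝓕.density / 2) ^ (1 / (k : ℝ)) with hc
  have hc0 : 0 < c := Real.rpow_pos_of_pos (by linarith) _
  have hck : c ^ k = 𝓕.density / 2 := by
    rw [hc, one_div, Real.rpow_inv_natCast_pow (by linarith) hk]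
  have hT := tendsto_natCast_rpow_one_sub_inv hα
  have hcT : Tendsto (fun n : ℕ => c * (n : ℝ) ^ (1 - 1 / α)) atTop atTop :=
    hT.const_mul_atTop hc0
  have hr : Tendsto (fun n : ℕ => q * (1 - m / (c * (n : ℝ) ^ (1 - 1 / α))) ^ (m - k)) atTop
      (𝓝 q) := by
    have h1 : Tendsto (fun n : ℕ => (m : ℝ) / (c * (n : ℝ) ^ (1 - 1 / α))) atTop (𝓝 0) :=
      tendsto_const_nhds.div_atTop hcT
    simpa using ((tendsto_const_nhds (x := (1 : ℝ)).sub h1).pow (m - k)).const_mul q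
  filter_upwards [hr.eventually (lt_mem_nhds hmq), eventually_gt_atTop 0,
    hcT.eventually_gt_atTop (m : ℝ), hT.eventually_gt_atTop 0,
    (tendsto_factorial_mul_ex_div_pow 𝓕).eventually (lt_mem_nhds (half_lt_self hπ))]
    with n h1 hn h2 h3 h4
  obtain ⟨H, hH, hHs⟩ := exists_spectralRadius_eq_maxFree hπ α n
  have : Nonempty (Fin n) := ⟨⟨0, hn⟩⟩
  have hlow := ex_div_mul_pow_le_maxFree hk hα0 hπ hn
  obtain ⟨x, hx, hx1, hxm⟩ := H.exists_lagrangian_eq_spectralRadius hα0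
  rw [← hHs, ← hxm] at hlow ⊢
  have hSN := KGraph.sum_le_card_rpow hα hx hx1
  rw [Fintype.card_fin] at hSN
  have hLS := H.lagrangian_le_sum_pow hx
  set N := (n : ℝ) ^ (1 - 1 / α) with hN
  set S := ∑ v, x v with hS
  have hS0 : 0 ≤ S := sum_nonneg fun v _ => hx v
  -- The radius is at most `S ^ k` and at least `(π / 2) * N ^ k`, so `S` tends to infinity with `N`
  -- and the error `m / S` vanishes.
  have hcS : c * N ≤ S := by
    refine le_of_pow_le_pow_left₀ hk hS0 ?_
    rw [mul_pow, hck]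
    refine le_trans ?_ (hlow.trans hLS)
    exact mul_le_mul_of_nonneg_right h4.le (by positivity)
  have hmS : (m : ℝ) < S := h2.trans_le hcS
  have hSpos : 0 < S := lt_of_le_of_lt (Nat.cast_nonneg m) hmS
  have hmain := KGraph.lagrangian_mul_pow_le hH hm hx
    (KGraph.le_one_of_sum_rpow_eq_one hα0 hx hx1) hmS.le
  rw [← hS] at hmain
  have hfrac : 1 - m / (c * N) ≤ 1 - m / S := by
    have : (m : ℝ) / S ≤ m / (c * N) :=
      div_le_div_of_nonneg_left (Nat.cast_nonneg _) (by positivity) hcS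
    linarith
  have hpos : 0 < 1 - m / (c * N) := by
    rw [sub_pos, div_lt_one (by positivity)]
    exact h2
  set r := (1 - m / (c * N)) ^ (m - k) with hr'
  have hr0 : 0 < r := pow_pos hpos _
  have hL0 := H.lagrangian_nonneg hx
  have hstep : H.lagrangian x * r ≤ (𝓕.ex m / m.choose k) * S ^ k := by
    have h5 : H.lagrangian x * (1 - m / S) ^ (m - k) ≤ (𝓕.ex m / m.choose k) * S ^ k := by
      have hSp : 0 < S ^ (m - k) := pow_pos hSpos _
      refine le_of_mul_le_mul_right ?_ hSp
      calc H.lagrangian x * (1 - m / S) ^ (m - k) * S ^ (m - k)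
          = H.lagrangian x * (S - m) ^ (m - k) := by
            rw [mul_assoc, ← mul_pow]
            congr 2
            field_simp
        _ ≤ _ := hmain
        _ = _ := by rw [mul_assoc, ← pow_add, Nat.add_sub_cancel' hm]
    exact (mul_le_mul_of_nonneg_left (pow_le_pow_left₀ hpos.le hfrac _) hL0).trans h5
  have hex : (0 : ℝ) ≤ 𝓕.ex m / m.choose k := by positivity
  refine le_of_mul_le_mul_right ?_ hr0
  calc H.lagrangian x * r ≤ (𝓕.ex m / m.choose k) * S ^ k := hstep
    _ ≤ (𝓕.ex m / m.choose k) * N ^ k :=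
        mul_le_mul_of_nonneg_left (pow_le_pow_left₀ hS0 hSN _) hex
    _ ≤ (q * r) * N ^ k := mul_le_mul_of_nonneg_right h1.le (by positivity)
    _ = q * N ^ k * r := by ring

end KFamily

/-! ### Small degrees, small coordinates and vertex deletion -/

namespace KGraph

variable {k : ℕ} {α : ℝ}

/-- If all coordinates of a maximal vector are at least `a`, then the degrees are large. -/
lemma spectralRadius_mul_rpow_le {V : Type*} [Fintype V] [Nonempty V] [DecidableEq V]
    (hα : 1 < α) (H : KGraph V (k + 1)) {x : V → ℝ} (h1 : ∑ v, x v ^ α = 1)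
    (hmax : H.lagrangian x = H.spectralRadius α) {a : ℝ} (ha : 0 < a) (hxa : ∀ v, a ≤ x v)
    (u : V) :
    H.spectralRadius α * a ^ (α - 1) ≤ k.factorial * H.degree u * a ^ k +
      ((∑ v, x v) ^ k - k.factorial * (Fintype.card V).choose k * a ^ k) := by
  have hα0 : 0 < α := by linarith
  have hx : ∀ v, 0 ≤ x v := fun v => ha.le.trans (hxa v)
  have hxu : 0 < x u := ha.trans_le (hxa u)
  have hE := H.factorial_mul_sum_edges_eq (Nat.succ_ne_zero k) hα0 hx h1 hmax u
  set l := H.spectralRadius α with hl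
  have hl0 : 0 ≤ l := H.spectralRadius_nonneg hα0
  set D := ∑ e ∈ H.edges with u ∈ e, ∏ v ∈ e.erase u, x v with hD
  have hDsum : ∑ e ∈ H.edges with u ∈ e, ∏ v ∈ e, x v = x u * D := by
    rw [hD, mul_sum]
    exact sum_congr rfl fun e he => (mul_prod_erase e x (mem_filter.1 he).2).symm
  have hDl : k.factorial * D = l * x u ^ (α - 1) := by
    have hp : x u ^ α = x u * x u ^ (α - 1) := by
      rw [← Real.rpow_one_add' hxu.le (by linarith)]
      congr 1
      ring
    rw [hDsum, hp, Nat.factorial_succ] at hE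
    push_cast at hE
    have hne : ((k : ℝ) + 1) * x u ≠ 0 := by positivity
    refine mul_left_cancel₀ hne ?_
    linarith
  -- Every product of `k` coordinates is at least `a ^ k`, so the excess over the link of `u` is at
  -- most the excess over all `k`-sets.
  have hsum : ∑ e ∈ H.edges with u ∈ e, (∏ v ∈ e.erase u, x v - a ^ k) ≤
      ∑ t ∈ univ.powersetCard k, (∏ v ∈ t, x v - a ^ k) := by
    have hinj : Set.InjOn (fun e : Finset V => e.erase u)
        ({e ∈ H.edges | u ∈ e} : Finset (Finset V)) := by
      intro e he f hf hef
      have he' := (mem_filter.1 he).2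
      have hf' := (mem_filter.1 hf).2
      rw [← insert_erase he', ← insert_erase hf']
      exact congrArg _ hef
    rw [← sum_image (f := fun t => ∏ v ∈ t, x v - a ^ k) hinj]
    refine sum_le_sum_of_subset_of_nonneg ?_ ?_
    · intro t ht
      obtain ⟨e, he, rfl⟩ := mem_image.1 ht
      rw [mem_filter] at he
      refine mem_powersetCard.2 ⟨subset_univ _, ?_⟩
      rw [card_erase_of_mem he.2, H.uniform e he.1, Nat.add_sub_cancel]
    · intro t ht _
      rw [sub_nonneg, ← (mem_powersetCard.1 ht).2, ← prod_const]
      exact prod_le_prod (fun _ _ => ha.le) fun v _ => hxa v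
  rw [sum_sub_distrib, sum_sub_distrib, sum_const, sum_const, card_powersetCard, nsmul_eq_mul,
    nsmul_eq_mul, card_univ, ← hD] at hsum
  have hes := factorial_mul_sum_powersetCard_le k univ x fun v _ => hx v
  have hdeg : ((#{e ∈ H.edges | u ∈ e} : ℕ) : ℝ) = H.degree u := rfl
  rw [hdeg] at hsum
  have hlow : l * a ^ (α - 1) ≤ k.factorial * D := by
    rw [hDl]
    exact mul_le_mul_of_nonneg_left
      (Real.rpow_le_rpow ha.le (hxa u) (by linarith)) hl0
  have := mul_le_mul_of_nonneg_left hsum (Nat.cast_nonneg (α := ℝ) k.factorial)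
  linarith

lemma spectralRadius_le_add_comap {n : ℕ} (hn : n ≠ 0) (hk : 2 ≤ k) (hα : 1 < α)
    (H : KGraph (Fin (n + 1)) k) {x : Fin (n + 1) → ℝ} (hx : ∀ v, 0 ≤ x v)
    (h1 : ∑ v, x v ^ α = 1) (hmax : H.lagrangian x = H.spectralRadius α) (u : Fin (n + 1))
    (hu : k * x u ^ α ≤ 1) :
    H.spectralRadius α ≤ (H.comap u.succAboveEmb).spectralRadius α +
      H.spectralRadius α * (x u ^ α * ((k : ℝ) - k / α + k ^ 2 / α * x u ^ α)) := by
  have hα0 : 0 < α := by linarith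
  have h := H.spectralRadius_sub_le hn (by omega) hα0 hx h1 hmax u
  have hl0 : 0 ≤ H.spectralRadius α := H.spectralRadius_nonneg hα0
  set l := H.spectralRadius α
  set l' := (H.comap u.succAboveEmb).spectralRadius α
  set z := x u ^ α with hz
  have hz0 : 0 ≤ z := Real.rpow_nonneg (hx u) _
  have hk2 : (2 : ℝ) ≤ k := by exact_mod_cast hk
  have hz1 : z < 1 := by nlinarith
  set r : ℝ := k / α with hr
  have hr0 : 0 ≤ r := by positivity
  -- The norm factor satisfies `(1 - z) ^ r ≤ exp (-r z) ≤ 1 / (1 + r z)`; multiplying out `(1 - k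
  -- z) * (1 + r z)` gives the claimed loss.
  have hw : 0 < (1 - z) ^ r := Real.rpow_pos_of_pos (by linarith) _
  have hwr : (1 - z) ^ r * (1 + r * z) ≤ 1 := by
    have h2 : (1 - z) ^ r ≤ Real.exp (-(r * z)) := by
      calc (1 - z) ^ r ≤ (Real.exp (-z)) ^ r :=
            Real.rpow_le_rpow (by linarith) (by linarith [Real.add_one_le_exp (-z)]) hr0
        _ = Real.exp (-(r * z)) := by rw [← Real.exp_mul]; congr 1; ring
    have h3 : 1 + r * z ≤ Real.exp (r * z) := by linarith [Real.add_one_le_exp (r * z)]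
    calc (1 - z) ^ r * (1 + r * z) ≤ Real.exp (-(r * z)) * Real.exp (r * z) :=
          mul_le_mul h2 h3 (by positivity) (Real.exp_pos _).le
      _ = 1 := by rw [← Real.exp_add]; simp
  have h4 : l * (1 - k * z) * (1 + r * z) ≤ l' := by
    have hA : 0 ≤ l * (1 - k * z) := mul_nonneg hl0 (by linarith)
    have h5 : l * (1 - k * z) * ((1 - z) ^ r * (1 + r * z)) ≤ l * (1 - k * z) :=
      mul_le_of_le_one_right hA hwr
    refine le_of_mul_le_mul_right ?_ hw
    linarith
  have h6 : (k : ℝ) ^ 2 / α = k * r := by rw [hr]; ring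
  rw [h6]
  linarith

lemma exists_degree_lt_of_notMem {𝓕 : KFamily k} {ε : ℝ} {n : ℕ} (hn : 0 < n)
    {H : KGraph (Fin n) k} (hH : H.IsFree 𝓕) (hnot : H ∉ 𝓕.largeMinDegree ε n) :
    ∃ u, (H.degree u : ℝ) < (1 - ε) * 𝓕.density * (n.choose (k - 1) : ℝ) := by
  have : Nonempty (Fin n) := ⟨⟨0, hn⟩⟩
  obtain ⟨u, hu⟩ := exists_eq_ciInf_of_finite (f := fun v => H.degree v)
  refine ⟨u, ?_⟩
  by_contra! h
  refine hnot ⟨hH, ?_⟩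
  rw [minDegree, ← hu]
  exact h

end KGraph

namespace KFamily

variable {k : ℕ} {α : ℝ}

/-- A maximal vector of an extremal `k`-graph with a vertex of small degree has a small
coordinate. -/
lemma eventually_exists_rpow_lt {𝓕 : KFamily (k + 1)} (hα : 1 < α) (hπ : 0 < 𝓕.density)
    {ε b : ℝ} (hε : ε < 1) (hb0 : 0 < b) (hb1 : b ≤ 1)
    (hb : (1 - ε) * 𝓕.density + 1 - (b ^ (1 / α)) ^ k < 𝓕.density * b ^ (1 - 1 / α)) :
    ∀ᶠ n : ℕ in atTop, ∀ H : KGraph (Fin n) (k + 1), H.IsFree 𝓕 →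
      H.spectralRadius α = 𝓕.maxFree α n → H ∉ 𝓕.largeMinDegree ε n →
      ∀ x : Fin n → ℝ, (∀ v, 0 ≤ x v) → ∑ v, x v ^ α = 1 →
      H.lagrangian x = H.spectralRadius α → ∃ u, x u ^ α < b / n := by
  have hα0 : 0 < α := by linarith
  set c := b ^ (1 / α) with hc
  have hc0 : 0 < c := Real.rpow_pos_of_pos hb0 _
  have hc1 : c ≤ 1 := Real.rpow_le_one hb0.le hb1 (by positivity)
  have hρ : Tendsto (fun n : ℕ => (1 - ε) * 𝓕.density + 1 -
      (k.factorial : ℝ) * n.choose k / (n : ℝ) ^ k * c ^ k) atTop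
      (𝓝 ((1 - ε) * 𝓕.density + 1 - c ^ k)) := by
    simpa using ((tendsto_factorial_mul_choose_div_pow k).mul_const (c ^ k)).const_sub
      ((1 - ε) * 𝓕.density + 1)
  have hτ := (tendsto_factorial_mul_ex_div_pow 𝓕).mul_const (b ^ (1 - 1 / α))
  filter_upwards [hρ.eventually_lt hτ hb, eventually_gt_atTop 0] with n hlt hn
  intro H hH hHs hnot x hx h1 hmax
  by_contra! hall
  have hn' : (0 : ℝ) < n := by exact_mod_cast hn
  have : Nonempty (Fin n) := ⟨⟨0, hn⟩⟩
  obtain ⟨u, hu⟩ := H.exists_degree_lt_of_notMem hn hH hnot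
  set N := (n : ℝ) ^ (1 - 1 / α) with hN
  have hN0 : 0 < N := Real.rpow_pos_of_pos hn' _
  set a := (b / n) ^ (1 / α) with ha
  have hbn : 0 < b / n := by positivity
  have ha0 : 0 < a := Real.rpow_pos_of_pos hbn _
  have hxa : ∀ v, a ≤ x v := by
    intro v
    have := Real.rpow_le_rpow hbn.le (hall v) (show (0 : ℝ) ≤ 1 / α by positivity)
    rwa [← Real.rpow_mul (hx v), mul_one_div_cancel hα0.ne', Real.rpow_one] at this
  -- `a` is `c` times the constant vector's coordinate, so all terms below are multiples of `N ^ k`,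
  -- which cancels.
  have hna : n * a = c * N := by
    rw [ha, hc, hN, Real.div_rpow hb0.le hn'.le, Real.rpow_sub hn', Real.rpow_one]
    ring
  have haN : a ^ (α - 1) * N = b ^ (1 - 1 / α) := by
    rw [ha, ← Real.rpow_mul hbn.le, show 1 / α * (α - 1) = 1 - 1 / α by field_simp,
      Real.div_rpow hb0.le hn'.le, ← hN, div_mul_cancel₀ _ hN0.ne']
  have hmain := H.spectralRadius_mul_rpow_le hα h1 hmax ha0 hxa u
  have hSN := KGraph.sum_le_card_rpow hα hx h1
  rw [Fintype.card_fin, ← hN] at hSN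
  have hSk := pow_le_pow_left₀ (sum_nonneg fun v _ => hx v) hSN k
  have hlow := ex_div_mul_pow_le_maxFree (Nat.succ_ne_zero k) hα0 hπ hn
  rw [← hHs, ← hN] at hlow
  rw [Fintype.card_fin] at hmain
  rw [Nat.add_sub_cancel] at hu
  set τ := ((k + 1).factorial : ℝ) * 𝓕.ex n / (n : ℝ) ^ (k + 1)
  set ρ := (k.factorial : ℝ) * n.choose k / (n : ℝ) ^ k with hρdef
  have hρn : (k.factorial : ℝ) * n.choose k = ρ * n ^ k := by
    rw [hρdef, div_mul_cancel₀ _ (by positivity)]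
  have hρ1 : (k.factorial : ℝ) * n.choose k ≤ n ^ k := by
    have := Nat.choose_le_pow_div (α := ℝ) k n
    rw [le_div_iff₀ (by positivity)] at this
    linarith
  have hL : τ * b ^ (1 - 1 / α) * N ^ k ≤ H.spectralRadius α * a ^ (α - 1) := by
    calc τ * b ^ (1 - 1 / α) * N ^ k = τ * N ^ (k + 1) * a ^ (α - 1) := by
          rw [← haN]; ring
      _ ≤ _ := mul_le_mul_of_nonneg_right hlow (Real.rpow_nonneg ha0.le _)
  have hπε : 0 ≤ (1 - ε) * 𝓕.density := mul_nonneg (by linarith) hπ.le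
  have hdeg : k.factorial * H.degree u * a ^ k ≤ (1 - ε) * 𝓕.density * N ^ k := by
    calc (k.factorial : ℝ) * H.degree u * a ^ k
        ≤ k.factorial * ((1 - ε) * 𝓕.density * n.choose k) * a ^ k := by gcongr
      _ = (1 - ε) * 𝓕.density * (k.factorial * n.choose k) * a ^ k := by ring
      _ ≤ (1 - ε) * 𝓕.density * n ^ k * a ^ k := by gcongr
      _ = (1 - ε) * 𝓕.density * (c ^ k * N ^ k) := by
          rw [mul_assoc, ← mul_pow, hna, mul_pow]
      _ ≤ (1 - ε) * 𝓕.density * (1 * N ^ k) := by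
          gcongr
          exact pow_le_one₀ hc0.le hc1
      _ = _ := by ring
  have hch : k.factorial * n.choose k * a ^ k = ρ * c ^ k * N ^ k := by
    rw [hρn, mul_assoc, ← mul_pow, hna, mul_pow, mul_assoc]
  rw [hch] at hmain
  have hfin : τ * b ^ (1 - 1 / α) * N ^ k ≤
      ((1 - ε) * 𝓕.density + 1 - ρ * c ^ k) * N ^ k := by linarith
  exact absurd (le_of_mul_le_mul_right hfin (pow_pos hN0 k)) (not_le.2 hlt)

/-- The leading term of the loss is `p * π * b` times the power of `n + 1`, with `p = k - k / α`. It
beats the assumed growth as soon as `b < 1 - ε'`. -/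
lemma eventually_maxFree_succ_le {𝓕 : KFamily k} (hk : 2 ≤ k) (hα : 1 < α)
    (hπ : 0 < 𝓕.density) {ε ε' : ℝ} (hε0 : 0 < ε) (hε1 : ε < 1)
    (hε' : ε' = ε * 𝓕.density * (α - 1) / (2 * k * α)) :
    ∃ c > 0, ∀ᶠ n : ℕ in atTop, ∀ H : KGraph (Fin (n + 1)) k, H.IsFree 𝓕 →
      H.spectralRadius α = 𝓕.maxFree α (n + 1) → H ∉ 𝓕.largeMinDegree ε (n + 1) →
      𝓕.maxFree α (n + 1) + c * ((n + 1 : ℕ) : ℝ) ^ ((k : ℝ) - k / α - 1) ≤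
        𝓕.maxFree α n + ((k : ℝ) - k / α) * (1 - ε') * 𝓕.density *
          ((n + 1 : ℕ) : ℝ) ^ ((k : ℝ) - k / α - 1) := by
  have hα0 : 0 < α := by linarith
  have hk2 : (2 : ℝ) ≤ k := by exact_mod_cast hk
  have hk0 : (0 : ℝ) < k := by linarith
  have hπ1 := density_le_one hπ
  set π := 𝓕.density with hπdef
  -- `δ` lies strictly between `ε * π / (2 * k)`, which exceeds `ε'`, and `ε * π / k`, below which a
  -- small coordinate is still forced.
  set δ : ℝ := 2 * ε * π / (3 * k) with hδ
  have hεπ : 0 < ε * π := mul_pos hε0 hπ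
  have hεπ1 : ε * π < 1 := by nlinarith
  have hδ0 : 0 < δ := by positivity
  have hkδ : k * δ = 2 / 3 * (ε * π) := by rw [hδ]; field_simp
  have hδ1 : δ < 1 := by nlinarith
  have hε'δ : ε' < δ := by
    have h1 : (α - 1) / α < 1 := by rw [div_lt_one hα0]; linarith
    have h2 : k * ε' = ε * π / 2 * ((α - 1) / α) := by rw [hε']; field_simp
    have h3 : k * ε' < k * δ := by
      rw [h2, hkδ]
      nlinarith
    exact lt_of_mul_lt_mul_left h3 hk0.le
  set b : ℝ := 1 - δ with hb
  have hb0 : 0 < b := by linarith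
  have hb1 : b < 1 := by linarith
  have hinv : 1 / α < 1 := by rw [div_lt_one hα0]; exact hα
  have hinv0 : 0 < 1 / α := by positivity
  obtain ⟨j, rfl⟩ : ∃ j, k = j + 1 := ⟨k - 1, by omega⟩
  have hbb : (1 - ε) * π + 1 - (b ^ (1 / α)) ^ j < π * b ^ (1 - 1 / α) := by
    have h1 : b ≤ b ^ (1 / α) := Real.self_le_rpow_of_le_one hb0.le hb1.le hinv.le
    have h2 : b ≤ b ^ (1 - 1 / α) :=
      Real.self_le_rpow_of_le_one hb0.le hb1.le (by linarith)
    have h3 : 1 + (j : ℝ) * (b - 1) ≤ (b ^ (1 / α)) ^ j :=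
      (one_add_mul_sub_le_pow (by linarith) j).trans (pow_le_pow_left₀ hb0.le h1 j)
    have h4 : π * b ≤ π * b ^ (1 - 1 / α) := mul_le_mul_of_nonneg_left h2 hπ.le
    have h5 : π * δ ≤ δ := mul_le_of_le_one_left hδ0.le hπ1
    push_cast at hkδ
    rw [hb] at h3 h4
    nlinarith
  set p : ℝ := ((j + 1 : ℕ) : ℝ) - ((j + 1 : ℕ) : ℝ) / α with hp
  have hp0 : 0 < p := by
    have : p = ((j + 1 : ℕ) : ℝ) * (1 - 1 / α) := by rw [hp]; ring
    rw [this]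
    exact mul_pos hk0 (by linarith)
  obtain ⟨q, hq1, hq2⟩ : ∃ q, π < q ∧ q < π * (1 - ε') / b := by
    refine exists_between ?_
    rw [lt_div_iff₀ hb0]
    exact mul_lt_mul_of_pos_left (by linarith) hπ
  rw [lt_div_iff₀ hb0] at hq2
  have hq0 : 0 < q := hπ.trans hq1
  -- Half of the gain; the other half absorbs the second-order term of the deletion loss.
  set c : ℝ := (p * (1 - ε') * π - q * b * p) / 2 with hcdef
  have hc0 : 0 < c := by
    have := mul_lt_mul_of_pos_right hq2 hp0
    rw [hcdef]
    linarith
  refine ⟨c, hc0, ?_⟩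
  have hz0 : Tendsto (fun n : ℕ => b / ((n + 1 : ℕ) : ℝ)) atTop (𝓝 0) :=
    (tendsto_const_nhds.div_atTop tendsto_natCast_atTop_atTop).comp (tendsto_add_atTop_nat 1)
  have hlim : Tendsto (fun n : ℕ => q * b *
      (p + ((j + 1 : ℕ) : ℝ) ^ 2 / α * (b / ((n + 1 : ℕ) : ℝ)))) atTop (𝓝 (q * b * p)) := by
    simpa using ((hz0.const_mul (((j + 1 : ℕ) : ℝ) ^ 2 / α)).const_add p).const_mul (q * b)
  have hkz : Tendsto (fun n : ℕ => ((j + 1 : ℕ) : ℝ) * (b / ((n + 1 : ℕ) : ℝ))) atTop (𝓝 0) := by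
    simpa using hz0.const_mul (((j + 1 : ℕ) : ℝ))
  filter_upwards [(tendsto_add_atTop_nat 1).eventually
      (eventually_exists_rpow_lt hα hπ hε1 hb0 hb1.le hbb),
    (tendsto_add_atTop_nat 1).eventually (eventually_maxFree_le (Nat.succ_ne_zero j) hα hπ hq1),
    hlim.eventually (gt_mem_nhds (show q * b * p < p * (1 - ε') * π - c by
      rw [hcdef]; rw [hcdef] at hc0; linarith)),
    hkz.eventually (gt_mem_nhds zero_lt_one), eventually_ne_atTop 0] with n hs hup hc2 hkn hn
  intro H hH hHs hnot
  obtain ⟨x, hx, h1, hmax⟩ := H.exists_lagrangian_eq_spectralRadius hα0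
  obtain ⟨u, hu⟩ := hs H hH hHs hnot x hx h1 hmax
  have hzu : 0 ≤ x u ^ α := Real.rpow_nonneg (hx u) _
  have hdel := H.spectralRadius_le_add_comap hn hk hα hx h1 hmax u
    ((mul_le_mul_of_nonneg_left hu.le hk0.le).trans hkn.le)
  have hcm := spectralRadius_le_maxFree (α := α) (hH.comap u.succAboveEmb)
  have hl0 : 0 ≤ H.spectralRadius α := H.spectralRadius_nonneg hα0
  rw [hHs, ← hp] at hdel
  rw [hHs] at hl0
  set m : ℝ := ((n + 1 : ℕ) : ℝ) with hm
  have hm0 : 0 < m := by rw [hm]; positivity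
  set l := 𝓕.maxFree α (n + 1) with hl
  set z := x u ^ α with hz
  have hpow : (m ^ (1 - 1 / α)) ^ (j + 1) = m * m ^ (p - 1) := by
    rw [← Real.rpow_mul_natCast hm0.le, Real.rpow_sub_one hm0.ne', mul_div_cancel₀ _ hm0.ne', hp]
    congr 1
    ring
  rw [hpow] at hup
  have hmp : 0 < m ^ (p - 1) := Real.rpow_pos_of_pos hm0 _
  have hK : (0 : ℝ) ≤ ((j + 1 : ℕ) : ℝ) ^ 2 / α := by positivity
  have hbm : 0 ≤ b / m := by positivity
  have hloss : l * (z * (p + ((j + 1 : ℕ) : ℝ) ^ 2 / α * z)) ≤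
      (p * (1 - ε') * π - c) * m ^ (p - 1) := by
    calc l * (z * (p + ((j + 1 : ℕ) : ℝ) ^ 2 / α * z))
        ≤ (q * (m * m ^ (p - 1))) * (b / m * (p + ((j + 1 : ℕ) : ℝ) ^ 2 / α * (b / m))) := by
          gcongr
      _ = (q * b * (p + ((j + 1 : ℕ) : ℝ) ^ 2 / α * (b / m))) * m ^ (p - 1) := by
          field_simp
      _ ≤ _ := mul_le_mul_of_nonneg_right hc2.le hmp.le
  linarith

end KFamily

/-! ### Divergence of the harmonic series and the conclusion -/

/-- A positive value must come from a larger one, so nonpositivity persists; perpetual positivity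
would make the harmonic sums bounded. -/
lemma exists_forall_ge_nonpos_of_add_div_le {d : ℕ → ℝ} {c : ℝ} (hc : 0 < c) {N : ℕ}
    (h : ∀ n, N ≤ n → 0 < d (n + 1) → d (n + 1) + c * (1 / ((n : ℝ) + 1)) ≤ d n) :
    ∃ n₁, N ≤ n₁ ∧ ∀ n, n₁ ≤ n → d n ≤ 0 := by
  by_cases hex : ∃ n₁, N ≤ n₁ ∧ d n₁ ≤ 0
  · obtain ⟨n₁, hN, hd⟩ := hex
    refine ⟨n₁, hN, fun n hn => ?_⟩
    induction n, hn using Nat.le_induction with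
    | base => exact hd
    | succ n hn ih =>
      by_contra! hpos
      have h1 := h n (hN.trans hn) hpos
      have h2 : 0 < c * (1 / ((n : ℝ) + 1)) := by positivity
      linarith
  · exfalso
    push Not at hex
    have hsum : ∀ n, N ≤ n → d n + c * ∑ i ∈ range n, (1 / ((i : ℝ) + 1)) ≤
        d N + c * ∑ i ∈ range N, (1 / ((i : ℝ) + 1)) := by
      intro n hn
      induction n, hn using Nat.le_induction with
      | base => exact le_rfl
      | succ n hn ih =>
        rw [sum_range_succ, mul_add]
        linarith [h n hn (hex _ (by omega))]
    obtain ⟨n, h1, h2⟩ := ((Real.tendsto_sum_range_one_div_nat_succ_atTop.const_mul_atTop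
      hc).eventually_gt_atTop (d N + c * ∑ i ∈ range N, (1 / ((i : ℝ) + 1)))
      |>.and (eventually_ge_atTop N)).exists
    linarith [hsum n h2, hex n h2]

theorem theorem3p1 (k : ℕ) (hk : 2 ≤ k) (α : ℝ) (hα : 1 < α) (ε : ℝ) (hε0 : 0 < ε) (hε1 : ε < 1)
    (𝓕 : KFamily k) (hπ : 0 < 𝓕.density)
    (ε' : ℝ) (hε' : ε' = ε * 𝓕.density * (α - 1) / (2 * k * α))
    (hgrowth : ∃ N : ℕ, ∀ n : ℕ, N ≤ n →
      maxSpectralRadius α (𝓕.largeMinDegree ε (n - 1)) +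
          ((k : ℝ) - k / α) * (1 - ε') * 𝓕.density * (n : ℝ) ^ ((k : ℝ) - k / α - 1) ≤
        maxSpectralRadius α (𝓕.largeMinDegree ε n)) :
    ∃ n₀ : ℕ, ∀ n : ℕ, n₀ ≤ n → ∀ H : KGraph (Fin n) k, H.IsFree 𝓕 →
      H.spectralRadius α ≤ maxSpectralRadius α (𝓕.largeMinDegree ε n) ∧
      (H.spectralRadius α = maxSpectralRadius α (𝓕.largeMinDegree ε n) →
        H ∈ 𝓕.largeMinDegree ε n) := by
  obtain ⟨N, hN⟩ := hgrowth
  obtain ⟨c, hc, hev⟩ := KFamily.eventually_maxFree_succ_le hk hα hπ hε0 hε1 hε'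
  obtain ⟨N', hN'⟩ := eventually_atTop.1 hev
  have hp : 0 ≤ (k : ℝ) - k / α := by
    rw [sub_nonneg]
    exact div_le_self (Nat.cast_nonneg _) hα.le
  set d : ℕ → ℝ := fun n => 𝓕.maxFree α n - maxSpectralRadius α (𝓕.largeMinDegree ε n) with hd
  have hstep : ∀ n, max N N' ≤ n → ∀ H : KGraph (Fin (n + 1)) k, H.IsFree 𝓕 →
      H.spectralRadius α = 𝓕.maxFree α (n + 1) → H ∉ 𝓕.largeMinDegree ε (n + 1) →
      d (n + 1) + c * (1 / ((n : ℝ) + 1)) ≤ d n := by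
    intro n hn H hH hHs hnot
    have h1 := hN' n ((le_max_right _ _).trans hn) H hH hHs hnot
    have h2 := hN (n + 1) (((le_max_left _ _).trans hn).trans n.le_succ)
    rw [Nat.add_sub_cancel] at h2
    -- The exponent is at least `-1`, so the gain is never smaller than a harmonic term.
    have h3 : c * (1 / ((n : ℝ) + 1)) ≤ c * ((n + 1 : ℕ) : ℝ) ^ ((k : ℝ) - k / α - 1) := by
      refine mul_le_mul_of_nonneg_left ?_ hc.le
      push_cast
      rw [one_div, ← Real.rpow_neg_one]
      refine Real.rpow_le_rpow_of_exponent_le ?_ (by linarith)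
      linarith [(Nat.cast_nonneg n : (0 : ℝ) ≤ n)]
    simp only [hd]
    linarith
  obtain ⟨n₁, hn₁, hle⟩ := exists_forall_ge_nonpos_of_add_div_le (d := d) hc
    (N := max N N') (by
      intro n hn hpos
      obtain ⟨H, hH, hHs⟩ := KFamily.exists_spectralRadius_eq_maxFree hπ α (n + 1)
      refine hstep n hn H hH hHs fun hmem => ?_
      have := spectralRadius_le_maxSpectralRadius (α := α) hmem
      simp only [hd] at hpos
      linarith)
  -- The shift by one leaves room for the equality case, which also uses `d ≤ 0` one index earlier:
  -- an extremal `H` outside `largeMinDegree` would force `d (n + 1) < d n ≤ 0`, whereas equality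
  -- gives `d (n + 1) ≥ 0`.
  refine ⟨n₁ + 1, fun n hn H hH => ?_⟩
  obtain ⟨n, rfl⟩ : ∃ m, n = m + 1 := ⟨n - 1, by omega⟩
  have hdn : 𝓕.maxFree α (n + 1) ≤ maxSpectralRadius α (𝓕.largeMinDegree ε (n + 1)) :=
    sub_nonpos.1 (hle (n + 1) (by omega))
  have hHle := KFamily.spectralRadius_le_maxFree (α := α) hH
  refine ⟨hHle.trans hdn, fun heq => ?_⟩
  by_contra hnot
  have hs := hstep n (by omega) H hH (le_antisymm hHle (heq ▸ hdn)) hnot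
  have hdn1 := hle n (by omega)
  have hpos : 0 < c * (1 / ((n : ℝ) + 1)) := by positivity
  have hd0 : 0 ≤ d (n + 1) := by
    simp only [hd]
    linarith
  linarith
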